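/- Let $N$ be a number of parties, $[N]=\{1,\dots,N\}$, and let $0$ denote the purifier, so that the full set of parties is $P=\{0,1,\dots,N\}$. An entropy vector is a collection $S=(S_X)$ of real numbers indexed by the non-empty $X\subseteq[N]$; put $S_X=S_{P\setminus X}$ if $0\in X\subsetneq P$, and $S_\varnothing=S_P=0$. For disjoint non-empty $X,Y\subseteq P$ let $I(X:Y)=S_X+S_Y-S_{X\cup Y}$. SA is the set of inequalities $I(X:Y)\ge 0$, and SSA the set of inequalities $I(X:Y\cup Z)\ge I(X:Y)$ for pairwise disjoint non-empty $X,Y,Z\subseteq P$. The correlation hypergraph of $S$ has vertex set $P$, and its hyperedges are the sets $X\subseteq P$ with $|X|\ge 2$ such that $I(Y:Z)\neq 0$ for every partition $X=Y\sqcup Z$ into two non-empty parts. Its line graph $L$ has the hyperedges as vertices, two distinct hyperedges being adjacent if they intersect. The entropy vector $S$ is called irreducible if it satisfies SA and SSA, $S_X\ne 0$ for all non-empty $X\subseteq[N]$, and every inclusion-maximal clique $Q$ of $L$ satisfies $Q^\cap:=\bigcap_{h\in Q}h=\varnothing$. A holographic graph model is a finite graph with vertex set $V$ and non-negative edge weights,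 together with a set $\partial V\subseteq V$ of boundary vertices, each labeled by exactly one party in $P$, such that every party labels at least one boundary vertex. It is simple if distinct boundary vertices have distinct labels, and a simple tree graph model if moreover the graph is a tree. For $X\subseteq P$, an $X$-cut is a set $C\subseteq V$ such that $C\cap\partial V$ is the set of all boundary vertices labeled by parties in $X$; its cost is the sum of the weights of the edges with exactly one endpoint in $C$. The model realizes $S$ if, for every non-empty $X\subseteq[N]$, $S_X$ is the minimum cost of an $X$-cut. **Theorem.** Let $S$ be an irreducible entropy vector. Then $S$ is realized by a holographic simple tree graph model if and only if the line graph $L$ of its correlation hypergraph is chordal, that is, every cycle of length at least four in $L$ has a chord. -/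

import Mathlib

/-! ## Entropy vectors -/

/-- The `N + 1` parties of an `N`-party system: the party `0` is the purifier. -/
abbrev Party (N : ℕ) : Type := Fin (N + 1)

/-- A subsystem is a set of parties (possibly containing the purifier). -/
abbrev Subsystem (N : ℕ) : Type := Finset (Party N)

/-- An `N`-party entropy vector: one real number for each of the `2 ^ N - 1` non-empty
subsystems which do not contain the purifier. -/
abbrev EntropyVector (N : ℕ) : Type :=
  {X : Subsystem N // X.Nonempty ∧ (0 : Party N) ∉ X} → ℝ

open Classical in
/-- The entropy of an arbitrary subsystem: the entry of the entropy vector if `X` is non-empty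
and does not contain the purifier, the entry of the complement of `X` if `X` contains the
purifier but is not the set of all parties, and `0` for the empty set and the set of all
parties. -/
noncomputable def EntropyVector.ent {N : ℕ} (S : EntropyVector N) (X : Subsystem N) : ℝ :=
  if h : X.Nonempty ∧ (0 : Party N) ∉ X then S ⟨X, h⟩
  else if h : Xᶜ.Nonempty ∧ (0 : Party N) ∉ Xᶜ then S ⟨Xᶜ, h⟩
  else 0

/-- The mutual information `I(X : Y)`. -/
noncomputable def EntropyVector.mutualInfo {N : ℕ} (S : EntropyVector N)
    (X Y : Subsystem N) : ℝ :=
  S.ent X + S.ent Y - S.ent (X ∪ Y)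

/-- The instances `I(X : Y)` of the mutual information: pairs of disjoint non-empty subsystems.
Both orders of the two arguments are listed; the mutual information is symmetric. -/
def miInstances (N : ℕ) : Set (Subsystem N × Subsystem N) :=
  {p | p.1.Nonempty ∧ p.2.Nonempty ∧ Disjoint p.1 p.2}

/-- All instances of subadditivity (including those of the Araki-Lieb inequality, where the
purifier appears): `I(X : Y) ≥ 0`. -/
def EntropyVector.SatisfiesSA {N : ℕ} (S : EntropyVector N) : Prop :=
  ∀ p ∈ miInstances N, 0 ≤ S.mutualInfo p.1 p.2

/-- All instances of strong subadditivity: `I(X : YZ) ≥ I(X : Y)` for pairwise disjoint non-empty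
subsystems, which may contain the purifier. -/
def EntropyVector.SatisfiesSSA {N : ℕ} (S : EntropyVector N) : Prop :=
  ∀ X Y Z : Subsystem N, X.Nonempty → Y.Nonempty → Z.Nonempty →
    Disjoint X Y → Disjoint X Z → Disjoint Y Z →
    S.mutualInfo X Y ≤ S.mutualInfo X (Y ∪ Z)

/-- The pattern of marginal independence: the set of vanishing instances of the mutual
information. -/
def EntropyVector.pmi {N : ℕ} (S : EntropyVector N) : Set (Subsystem N × Subsystem N) :=
  {p ∈ miInstances N | S.mutualInfo p.1 p.2 = 0}

/-! ## The correlation hypergraph and its line graph -/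

/-- The `β`-set of a subsystem `X`: the instances `I(Y : Z)` with `Y ∪ Z = X`. -/
def betaSet {N : ℕ} (X : Subsystem N) : Set (Subsystem N × Subsystem N) :=
  {p ∈ miInstances N | p.1 ∪ p.2 = X}

/-- The `β`-set of `X` is positive if it lies in the complement of the pattern of marginal
independence in the set of all instances of the mutual information. -/
def EntropyVector.IsPositive {N : ℕ} (S : EntropyVector N) (X : Subsystem N) : Prop :=
  betaSet X ⊆ miInstances N \ S.pmi

/-- The correlation hypergraph: the vertices are the parties, and the hyperedges are the
subsystems with at least two parties whose `β`-set is positive. -/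
def EntropyVector.correlationHypergraph {N : ℕ} (S : EntropyVector N) :
    Hypergraph (Party N) where
  vertexSet := Set.univ
  edgeSet := (fun X : Subsystem N => (X : Set (Party N))) '' {X | 2 ≤ X.card ∧ S.IsPositive X}
  subset_vertexSet_of_mem_edgeSet' := fun _ _ => Set.subset_univ _

/-- The line graph of a hypergraph: the intersection graph of its set of hyperedges. -/
def Hypergraph.intersectionGraph {α : Type*} (H : Hypergraph α) : SimpleGraph H.edgeSet where
  Adj e f := e ≠ f ∧ ((e : Set α) ∩ (f : Set α)).Nonempty
  symm := ⟨fun e f h => ⟨h.1.symm, by rw [Set.inter_comm]; exact h.2⟩⟩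
  loopless := ⟨fun _ h => h.1 rfl⟩

/-- The line graph of the correlation hypergraph. -/
def EntropyVector.lineGraph {N : ℕ} (S : EntropyVector N) :
    SimpleGraph S.correlationHypergraph.edgeSet :=
  S.correlationHypergraph.intersectionGraph

/-- A graph is chordal if every cycle of length at least four has a chord: an edge of the graph
which joins two vertices of the cycle and is not an edge of the cycle. -/
def SimpleGraph.IsChordalGraph {V : Type*} (G : SimpleGraph V) : Prop :=
  ∀ (u : V) (c : G.Walk u u), c.IsCycle → 4 ≤ c.length →
    ∃ x ∈ c.support, ∃ y ∈ c.support, G.Adj x y ∧ s(x, y) ∉ c.edges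

/-- A max-clique: a clique which is maximal with respect to inclusion. -/
def SimpleGraph.IsMaxClique {V : Type*} (G : SimpleGraph V) (Q : Set V) : Prop :=
  Maximal (fun K : Set V => G.IsClique K) Q

/-- An entropy vector is irreducible if it satisfies all instances of SA and SSA, has no
vanishing entries, and for every max-clique of the line graph of its correlation hypergraph the
intersection of all hyperedges in the clique is empty. -/
structure EntropyVector.IsIrreducible {N : ℕ} (S : EntropyVector N) : Prop where
  sa : S.SatisfiesSA
  ssa : S.SatisfiesSSA
  ne_zero : ∀ X, S X ≠ 0
  inter_eq_empty : ∀ Q : Set S.correlationHypergraph.edgeSet, S.lineGraph.IsMaxClique Q →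
    ⋂ h ∈ Q, (h : Set (Party N)) = ∅

/-! ## Holographic graph models -/

/-- An `N`-party holographic graph model: a finite graph with non-negative edge weights, and a
set of boundary vertices, each labeled by one party, such that each party labels at least one
boundary vertex. Only the values of `weight` on the edges of the graph matter. -/
structure HolographicGraphModel (N : ℕ) where
  V : Type
  finite_V : Finite V
  graph : SimpleGraph V
  weight : Sym2 V → ℝ
  weight_nonneg : ∀ e ∈ graph.edgeSet, 0 ≤ weight e
  boundary : Set V
  label : boundary → Party N
  label_surjective : Function.Surjective label

namespace HolographicGraphModel

/-- A graph model is simple if distinct boundary vertices are labeled by distinct parties. -/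
def IsSimple {N : ℕ} (M : HolographicGraphModel N) : Prop := Function.Injective M.label

/-- A simple tree graph model: simple, and the graph is connected without cycles. -/
def IsSimpleTree {N : ℕ} (M : HolographicGraphModel N) : Prop := M.IsSimple ∧ M.graph.IsTree

/-- The cut edges of a cut `C`: the edges with one endpoint in `C` and one outside `C`. -/
def cutEdges {N : ℕ} (M : HolographicGraphModel N) (C : Set M.V) : Set (Sym2 M.V) :=
  {e ∈ M.graph.edgeSet | ∃ v ∈ C, ∃ v' ∉ C, e = s(v, v')}

theorem cutEdges_finite {N : ℕ} (M : HolographicGraphModel N) (C : Set M.V) :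
    (M.cutEdges C).Finite := by
  have := M.finite_V
  exact Set.toFinite _

/-- The cost of a cut: the sum of the weights of its cut edges. -/
noncomputable def cost {N : ℕ} (M : HolographicGraphModel N) (C : Set M.V) : ℝ :=
  ∑ e ∈ (M.cutEdges_finite C).toFinset, M.weight e

/-- `C` is an `X`-cut if the boundary vertices in `C` are exactly the boundary vertices labeled
by the parties in `X`. -/
def IsCut {N : ℕ} (M : HolographicGraphModel N) (X : Subsystem N) (C : Set M.V) : Prop :=
  C ∩ M.boundary = Subtype.val '' {b : M.boundary | M.label b ∈ X}

/-- A min-cut for `X` is an `X`-cut of minimum cost. -/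
def IsMinCut {N : ℕ} (M : HolographicGraphModel N) (X : Subsystem N) (C : Set M.V) : Prop :=
  M.IsCut X C ∧ ∀ C' : Set M.V, M.IsCut X C' → M.cost C ≤ M.cost C'

/-- `M` realizes the entropy vector `S` if each entry of `S` is the entropy of the corresponding
subsystem in `M`, that is, the cost of a min-cut. -/
def Realizes {N : ℕ} (M : HolographicGraphModel N) (S : EntropyVector N) : Prop :=
  ∀ X, ∃ C : Set M.V, M.IsMinCut X.1 C ∧ M.cost C = S X

end HolographicGraphModel

/-! The entropies extend to a symmetric submodular function `f` on subsets of `P`, positive on all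
non-trivial ones. The hyperedges are the correlated sets with at least two parties.

From tree to chordality: assign to each hyperedge an inclusion-minimal min-cut. Such a cut is
connected, because a disconnection would split the hyperedge into independent parts
(`isIndecomposable_of_isLeastCut`), and minimal min-cuts of disjoint subsystems are disjoint
(`disjoint_of_isLeastCut`). So `L` is an intersection graph of subtrees of a tree, hence chordal
(`isChordalGraph_of_subtrees`).

From chordality to tree: consider the bipartitions of `P` with both sides correlated. If two of them
crossed, their four sides would form a chordless 4-cycle in `L`, so the sides avoiding the purifier
are laminar; irreducibility puts the singletons among them. A laminar family is a rooted tree; the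
edge above `K` gets weight `f K`. Any cut is, up to complement, a symmetric difference of the
branches below its cut edges, and `f` is subadditive under symmetric difference, so no cut is
cheaper than `f` (`le_cost_of_isCut`). The bound is attained on the family, and every subsystem
arises from such bipartitions by complements and independent unions (`IsPureEntropy.induction_on`),
which preserve attainment. -/

/-! ## Pure-state entropy functions -/

section EntropyFunction

variable {α : Type*} [Fintype α] [DecidableEq α]

/-- A symmetric submodular set function which vanishes on the empty set and is positive on all
non-trivial subsets. -/
structure IsPureEntropy (f : Finset α → ℝ) : Prop where
  empty : f ∅ = 0
  compl : ∀ X, f Xᶜ = f X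
  submod : ∀ X Y, f (X ∪ Y) + f (X ∩ Y) ≤ f X + f Y
  pos : ∀ X, X.Nonempty → Xᶜ.Nonempty → 0 < f X

/-- A non-empty set is correlated if it is not the union of two independent non-empty parts. -/
def IsCorrelated (f : Finset α → ℝ) (X : Finset α) : Prop :=
  X.Nonempty ∧ ∀ Y Z : Finset α, Y.Nonempty → Z.Nonempty → Disjoint Y Z → Y ∪ Z = X →
    f Y + f Z ≠ f X

omit [Fintype α] in
theorem isCorrelated_singleton (f : Finset α → ℝ) (a : α) : IsCorrelated f {a} := by
  refine ⟨Finset.singleton_nonempty a, fun Y Z hY hZ hd hu => ?_⟩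
  have h := Finset.card_union_of_disjoint hd
  rw [hu, Finset.card_singleton] at h
  have := hY.card_pos
  have := hZ.card_pos
  omega

namespace IsPureEntropy

variable {f : Finset α → ℝ}

theorem union_le (hf : IsPureEntropy f) {Y Z : Finset α} (h : Disjoint Y Z) :
    f (Y ∪ Z) ≤ f Y + f Z := by
  have := hf.submod Y Z
  rw [Finset.disjoint_iff_inter_eq_empty.mp h, hf.empty] at this
  linarith

theorem nonneg (hf : IsPureEntropy f) (X : Finset α) : 0 ≤ f X := by
  have h := hf.union_le (disjoint_compl_right (a := X))
  rw [Finset.union_compl, ← Finset.compl_empty, hf.compl, hf.compl, hf.empty] at h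
  linarith

/-- Submodularity of `Y' ∪ Z` and `Y`: discarding part of `Y` cannot create correlation with `Z`. -/
theorem indep_mono_left (hf : IsPureEntropy f) {Y Z Y' : Finset α} (h : Disjoint Y Z)
    (e : f Y + f Z = f (Y ∪ Z)) (hY : Y' ⊆ Y) : f Y' + f Z = f (Y' ∪ Z) := by
  have h1 := hf.submod (Y' ∪ Z) Y
  have h2 : Y' ∪ Z ∪ Y = Y ∪ Z := by grind
  have h3 : (Y' ∪ Z) ∩ Y = Y' := by
    rw [Finset.disjoint_left] at h
    grind
  rw [h2, h3] at h1
  have := hf.union_le (h.mono_left hY)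
  linarith

theorem indep_mono (hf : IsPureEntropy f) {Y Z Y' Z' : Finset α} (h : Disjoint Y Z)
    (e : f Y + f Z = f (Y ∪ Z)) (hY : Y' ⊆ Y) (hZ : Z' ⊆ Z) :
    f Y' + f Z' = f (Y' ∪ Z') := by
  have h1 := hf.indep_mono_left h e hY
  rw [add_comm, Finset.union_comm] at h1 ⊢
  exact hf.indep_mono_left (h.mono_left hY).symm h1 hZ

/-- By symmetry, submodularity of `X` and `Yᶜ` bounds `f (X \ Y) + f (Y \ X)`; subadditivity does
the rest. -/
theorem symmDiff_le (hf : IsPureEntropy f) (X Y : Finset α) :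
    f (symmDiff X Y) ≤ f X + f Y := by
  have h1 := hf.submod X Yᶜ
  have h2 : X ∩ Yᶜ = X \ Y := by grind [Finset.mem_compl]
  have h3 : (X ∪ Yᶜ)ᶜ = Y \ X := by grind [Finset.mem_compl]
  rw [← hf.compl (X ∪ Yᶜ), h2, h3, hf.compl] at h1
  have h4 : Disjoint (X \ Y) (Y \ X) := disjoint_sdiff_sdiff
  have h5 := hf.union_le h4
  have h6 : symmDiff X Y = X \ Y ∪ Y \ X := rfl
  rw [h6]
  linarith

/-- Otherwise the traces of `X` on `Y` and `Z` would be non-empty, and independent by `indep_mono`.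
-/
theorem _root_.IsCorrelated.subset_or_subset (hf : IsPureEntropy f) {X Y Z : Finset α}
    (hX : IsCorrelated f X) (h : Disjoint Y Z) (e : f Y + f Z = f (Y ∪ Z)) (hs : X ⊆ Y ∪ Z) :
    X ⊆ Y ∨ X ⊆ Z := by
  by_contra! hc
  have hu : X ∩ Y ∪ X ∩ Z = X := by grind
  refine hX.2 (X ∩ Y) (X ∩ Z) ?_ ?_
    (h.mono Finset.inter_subset_right Finset.inter_subset_right) hu ?_
  · obtain ⟨a, ha, ha'⟩ := Finset.not_subset.mp hc.2
    exact ⟨a, by grind⟩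
  · obtain ⟨a, ha, ha'⟩ := Finset.not_subset.mp hc.1
    exact ⟨a, by grind⟩
  · rw [hf.indep_mono h e Finset.inter_subset_right Finset.inter_subset_right, hu]

/-- Keep splitting into independent parts and retain the part containing `a`, until it is
correlated. -/
theorem exists_component (hf : IsPureEntropy f) {a : α} (X : Finset α) (ha : a ∈ X) :
    ∃ W, IsCorrelated f W ∧ a ∈ W ∧ W ⊆ X ∧ f W + f (X \ W) = f X := by
  induction X using Finset.strongInduction with
  | H X ih =>
    by_cases hX : IsCorrelated f X
    · exact ⟨X, hX, ha, subset_rfl, by simp [hf.empty]⟩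
    · have hX' : ∃ Y Z : Finset α, Y.Nonempty ∧ Z.Nonempty ∧ Disjoint Y Z ∧ Y ∪ Z = X ∧
          f Y + f Z = f X := by
        by_contra! h
        exact hX ⟨⟨a, ha⟩, h⟩
      have key : ∀ Y Z : Finset α, Z.Nonempty → Disjoint Y Z → Y ∪ Z = X →
          f Y + f Z = f X → a ∈ Y →
          ∃ W, IsCorrelated f W ∧ a ∈ W ∧ W ⊆ X ∧ f W + f (X \ W) = f X := by
        intro Y Z hZ hd hu he haY
        have hss : Y ⊂ X := by
          obtain ⟨z, hz⟩ := hZ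
          refine Finset.ssubset_iff_subset_ne.mpr ⟨by grind, ?_⟩
          rintro rfl
          exact Finset.disjoint_left.mp hd (by grind) hz
        obtain ⟨W, hW, haW, hWY, hWe⟩ := ih Y hss haY
        have hWX : W ⊆ X := hWY.trans hss.subset
        refine ⟨W, hW, haW, hWX, ?_⟩
        have h1 : Disjoint (Y \ W) Z := hd.mono_left Finset.sdiff_subset
        have h2 : Y \ W ∪ Z = X \ W := by
          have h := Finset.disjoint_left.mp hd
          grind
        have h3 := hf.union_le h1
        have h4 := hf.union_le (Finset.disjoint_sdiff (s := W) (t := X))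
        rw [Finset.union_sdiff_of_subset hWX] at h4
        rw [h2] at h3
        linarith
      obtain ⟨Y, Z, hY, hZ, hd, hu, he⟩ := hX'
      rw [← hu, Finset.mem_union] at ha
      rcases ha with ha | ha
      · exact key Y Z hZ hd hu he ha
      · exact key Z Y hY hd.symm (by rw [Finset.union_comm, hu]) (by linarith) ha

/-- The complement of a component of the complement of a correlated set is correlated. -/
theorem isCorrelated_compl_component (hf : IsPureEntropy f) {X K : Finset α}
    (hX : IsCorrelated f X) (hKX : K ⊆ Xᶜ)
    (e : f K + f (Xᶜ \ K) = f Xᶜ) : IsCorrelated f Kᶜ := by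
  obtain ⟨x, hx⟩ := hX.1
  have hXK : X ⊆ Kᶜ := by grind [Finset.mem_compl]
  refine ⟨⟨x, hXK hx⟩, fun Y Z hY hZ hd hu he => ?_⟩
  -- If `X` lies in `Y`, then `Z` lies in the remainder `Xᶜ \ K`, hence is independent of `K`. So `f
  -- K + f Z = f Yᶜ = f Y`, while `f Y + f Z = f K`; together `f Z = 0`, against positivity.
  have key : ∀ Y Z : Finset α, Z.Nonempty → Disjoint Y Z → Y ∪ Z = Kᶜ →
      f Y + f Z = f Kᶜ → X ⊆ Y → False := by
    intro Y Z hZ hd hu he hXY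
    have hd' := Finset.disjoint_left.mp hd
    have hZR : Z ⊆ Xᶜ \ K := by
      intro z hz
      have hzK : z ∈ Kᶜ := hu ▸ Finset.mem_union_right Y hz
      have hzX : z ∉ X := fun h => hd' (hXY h) hz
      simp only [Finset.mem_sdiff, Finset.mem_compl] at hzK ⊢
      exact ⟨hzX, hzK⟩
    have hKR : K ∪ Xᶜ \ K = Xᶜ := Finset.union_sdiff_of_subset hKX
    have h1 : f K + f Z = f (K ∪ Z) :=
      hf.indep_mono Finset.disjoint_sdiff (by rw [e, hKR]) subset_rfl hZR
    have h2 : K ∪ Z = Yᶜ := by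
      ext a
      have h3 := Finset.ext_iff.mp hu a
      have h4 := @hd' a
      simp only [Finset.mem_union, Finset.mem_compl] at h3 ⊢
      tauto
    rw [h2, hf.compl] at h1
    rw [hf.compl] at he
    have : 0 < f Z := hf.pos Z hZ ⟨x, Finset.mem_compl.mpr (hd' (hXY hx))⟩
    linarith
  rcases hX.subset_or_subset hf hd (by rw [he, hu]) (hu ▸ hXK) with h | h
  · exact key Y Z hZ hd hu he h
  · exact key Z Y hY hd.symm (by rw [Finset.union_comm, hu]) (by linarith) h

/-- To prove a property of all sets, it suffices to show that it holds for the correlated sets with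
correlated complement, and that it is inherited by complements and independent unions. -/
theorem induction_on (hf : IsPureEntropy f) {m : Finset α → Prop} (empty : m ∅)
    (compl : ∀ X, m X → m Xᶜ)
    (union : ∀ Y Z, Disjoint Y Z → f Y + f Z = f (Y ∪ Z) → m Y → m Z → m (Y ∪ Z))
    (split : ∀ K, IsCorrelated f K → IsCorrelated f Kᶜ → m K) (X : Finset α) : m X := by
  -- Such an `R` is assembled from components of `Xᶜ`; each of them has a correlated complement, so
  -- `split` applies to it.
  have key : ∀ X, IsCorrelated f X → ∀ R, R ⊆ Xᶜ → f R + f (Xᶜ \ R) = f Xᶜ → m R := by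
    intro X hX R
    induction R using Finset.strongInduction with
    | H R ih =>
      intro hR he
      rcases R.eq_empty_or_nonempty with rfl | ⟨a, ha⟩
      · exact empty
      · obtain ⟨K, hK, haK, hKR, hKe⟩ := hf.exists_component R ha
        have hu : K ∪ R \ K = R := Finset.union_sdiff_of_subset hKR
        have hd : Disjoint K (R \ K) := Finset.disjoint_sdiff
        have hdR : Disjoint R (Xᶜ \ R) := Finset.disjoint_sdiff
        have huR : R ∪ Xᶜ \ R = Xᶜ := Finset.union_sdiff_of_subset hR
        have aux : ∀ T ⊆ R, f T + f (R \ T) = f R → f T + f (Xᶜ \ T) = f Xᶜ := by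
          intro T hT hTe
          have h1 := hf.union_le (hdR.mono_left (Finset.sdiff_subset (s := R) (t := T)))
          have h2 : R \ T ∪ Xᶜ \ R = Xᶜ \ T := by
            ext a
            have h4 := @hT a
            have h5 := @hR a
            simp only [Finset.mem_union, Finset.mem_sdiff]
            tauto
          have h3 := hf.union_le (Finset.disjoint_sdiff (s := T) (t := Xᶜ))
          rw [Finset.union_sdiff_of_subset (hT.trans hR)] at h3
          rw [h2] at h1
          linarith
        rw [← hu]
        refine union _ _ hd (by rw [hKe, hu]) (split K hK ?_) (ih _ ?_ ?_ ?_)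
        · exact hf.isCorrelated_compl_component hX (hKR.trans hR) (aux K hKR hKe)
        · exact Finset.sdiff_ssubset hKR ⟨a, haK⟩
        · exact Finset.sdiff_subset.trans hR
        · refine aux _ Finset.sdiff_subset ?_
          rw [Finset.sdiff_sdiff_eq_self hKR]
          linarith
  induction X using Finset.strongInduction with
  | H X ih =>
    rcases X.eq_empty_or_nonempty with rfl | ⟨a, ha⟩
    · exact empty
    · obtain ⟨K, hK, haK, hKX, hKe⟩ := hf.exists_component X ha
      have hu : K ∪ X \ K = X := Finset.union_sdiff_of_subset hKX
      rw [← hu]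
      refine union _ _ Finset.disjoint_sdiff (by rw [hKe, hu]) ?_
        (ih _ (Finset.sdiff_ssubset hKX ⟨a, haK⟩))
      -- `K` itself need not have a correlated complement, so `m K` is reached through `m Kᶜ`.
      have := compl _ (key K hK Kᶜ subset_rfl (by simp [hf.empty]))
      rwa [compl_compl] at this

end IsPureEntropy

end EntropyFunction

/-! ## Intersection graphs of subtrees -/

namespace SimpleGraph

variable {W : Type*}

/-- A set of vertices which cannot be split into two non-empty parts without an edge between
them. -/
def IsIndecomposable (T : SimpleGraph W) (C : Set W) : Prop :=
  ∀ A : Set W, (C ∩ A).Nonempty → (C \ A).Nonempty → ∃ u ∈ C ∩ A, ∃ v ∈ C \ A, T.Adj u v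

/-- The edge is where the walk first enters `C`. The stretch before it stays outside `C`, so it
survives deletion of that edge. -/
theorem exists_entering_edge (T : SimpleGraph W) (C : Set W) {y x : W} (p : T.Walk y x)
    (hy : y ∉ C) (hx : x ∈ C) :
    ∃ a b, T.Adj a b ∧ a ∈ C ∧ b ∉ C ∧ (T.deleteEdges {s(a, b)}).Reachable b y := by
  induction p with
  | nil => exact absurd hx hy
  | @cons y z x h p ih =>
    by_cases hz : z ∈ C
    · exact ⟨z, y, h.symm, hz, hy, Reachable.refl _⟩
    · obtain ⟨a, b, hab, ha, hb, hr⟩ := ih hz hx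
      refine ⟨a, b, hab, ha, hb, hr.trans (Adj.reachable ?_)⟩
      rw [deleteEdges_adj]
      refine ⟨h.symm, ?_⟩
      simp only [Set.mem_singleton_iff, Sym2.eq_iff, not_or, not_and]
      exact ⟨fun e => absurd (e ▸ ha) hz, fun _ e => absurd (e ▸ ha) hy⟩

/-- `B` is the component of `b` once the bridge `ab` entering `C` is deleted. An indecomposable set
meeting both sides contains both `a` and `b`; but `b ∉ C`, and `a ∈ C` is not in `D`. -/
theorem IsTree.exists_separating_edge {T : SimpleGraph W} (hT : T.IsTree) {C D : Set W}
    (hC : T.IsIndecomposable C) (hD : T.IsIndecomposable D) (hCn : C.Nonempty)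
    (hDn : D.Nonempty) (hCD : Disjoint C D) :
    ∃ (B : Set W) (a b : W), Disjoint C B ∧ D ⊆ B ∧
      ∀ u ∉ B, ∀ v ∈ B, T.Adj u v → u = a ∧ v = b := by
  obtain ⟨x, hx⟩ := hCn
  obtain ⟨y, hy⟩ := hDn
  obtain ⟨p⟩ := hT.connected.preconnected y x
  obtain ⟨a, b, hab, ha, hb, hr⟩ :=
    T.exists_entering_edge C p (fun h => Set.disjoint_left.mp hCD h hy) hx
  have hbr : ¬ (T.deleteEdges {s(a, b)}).Reachable b a := fun h =>
    isBridge_iff.mp (isAcyclic_iff_forall_adj_isBridge.mp hT.isAcyclic hab) h.symm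
  have hcross : ∀ u ∉ {v | (T.deleteEdges {s(a, b)}).Reachable b v},
      ∀ v ∈ {v | (T.deleteEdges {s(a, b)}).Reachable b v}, T.Adj u v → u = a ∧ v = b := by
    intro u hu v hv huv
    by_contra hne
    refine hu (Reachable.trans hv (Adj.reachable ?_))
    rw [deleteEdges_adj]
    refine ⟨huv.symm, ?_⟩
    simp only [Set.mem_singleton_iff, Sym2.eq_iff, not_or, not_and]
    refine ⟨fun e => absurd (e ▸ hv) hbr, fun e e' => hne ⟨e', e⟩⟩
  refine ⟨{v | (T.deleteEdges {s(a, b)}).Reachable b v}, a, b, ?_, ?_, hcross⟩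
  · rw [Set.disjoint_left]
    intro z hz hzB
    obtain ⟨u, hu, v, hv, huv⟩ := hC _ ⟨z, hz, hzB⟩ ⟨a, ha, hbr⟩
    exact hb ((hcross v hv.2 u hu.2 huv.symm).2 ▸ hu.1)
  · intro z hz
    by_contra hzB
    obtain ⟨u, hu, v, hv, huv⟩ := hD _ ⟨y, hy, hr⟩ ⟨z, hz, hzB⟩
    exact Set.disjoint_left.mp hCD ha ((hcross v hv.2 u hu.2 huv.symm).1 ▸ hv.1)

theorem Walk.IsCycle.not_mem_edges_of_lt {V : Type*} {G : SimpleGraph V} {u : V}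
    {c : G.Walk u u} (hc : c.IsCycle) {i j : ℕ} (hij : i + 2 ≤ j) (hj : j < c.length)
    -- This excludes the first and last indices, which are neighbours across the base point.
    (h0 : i = 0 → j + 1 < c.length) : s(c.getVert i, c.getVert j) ∉ c.edges := by
  rw [Walk.mk_mem_edges_iff_exists]
  rintro ⟨k, hk, he⟩
  have inj : ∀ p q, p < c.length → q < c.length → c.getVert p = c.getVert q → p = q :=
    fun p q hp hq h => hc.getVert_injOn' (by simp only [Set.mem_ofPred_eq]; omega)
      (by simp only [Set.mem_ofPred_eq]; omega) h
  have wrap : ∀ q, q < c.length → c.getVert (k + 1) = c.getVert q →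
      q = k + 1 ∨ (q = 0 ∧ k + 1 = c.length) := by
    intro q hq h
    rcases Nat.lt_or_ge (k + 1) c.length with hk' | hk'
    · exact Or.inl (inj _ _ hq hk' h.symm)
    · have hkl : k + 1 = c.length := by omega
      refine Or.inr ⟨inj _ _ hq (by omega) ?_, hkl⟩
      rw [← h, hkl, Walk.getVert_length, Walk.getVert_zero]
  rcases Sym2.eq_iff.mp he with ⟨h1, h2⟩ | ⟨h1, h2⟩
  · have := inj _ _ hk (by omega) h1
    have := wrap _ hj h2
    omega
  · have := inj _ _ hk hj h1
    have := wrap _ (by omega) h2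
    omega

/-- Intersection graphs of subtrees of a tree are chordal. -/
theorem isChordalGraph_of_subtrees {V : Type*} {G : SimpleGraph V} {T : SimpleGraph W}
    (hT : T.IsTree) (C : V → Set W) (hC : ∀ x, T.IsIndecomposable (C x))
    (hne : ∀ x, (C x).Nonempty)
    (hadj : ∀ x y, G.Adj x y ↔ x ≠ y ∧ (C x ∩ C y).Nonempty) : G.IsChordalGraph := by
  intro u c hc hlen
  have inj : ∀ p q, p < c.length → q < c.length → c.getVert p = c.getVert q → p = q :=
    fun p q hp hq h => hc.getVert_injOn' (by simp only [Set.mem_ofPred_eq]; omega)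
      (by simp only [Set.mem_ofPred_eq]; omega) h
  have chord : ∀ i j, i + 2 ≤ j → j < c.length → (i = 0 → j + 1 < c.length) →
      (C (c.getVert i) ∩ C (c.getVert j)).Nonempty →
      ∃ x ∈ c.support, ∃ y ∈ c.support, G.Adj x y ∧ s(x, y) ∉ c.edges := by
    intro i j hij hj h0 hn
    refine ⟨_, c.getVert_mem_support i, _, c.getVert_mem_support j, (hadj _ _).mpr ⟨?_, hn⟩,
      hc.not_mem_edges_of_lt hij hj h0⟩
    intro h
    have := inj _ _ (by omega) hj h
    omega
  by_cases h02 : (C (c.getVert 0) ∩ C (c.getVert 2)).Nonempty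
  · exact chord 0 2 (by omega) (by omega) (by omega) h02
  obtain ⟨B, a, b, h0B, h2B, hcr⟩ := hT.exists_separating_edge (hC (c.getVert 0))
    (hC (c.getVert 2)) (hne _) (hne _)
    (Set.disjoint_iff_inter_eq_empty.mpr (Set.not_nonempty_iff_eq_empty.mp h02))
  have hinter : ∀ i, i < c.length → (C (c.getVert i) ∩ C (c.getVert (i + 1))).Nonempty :=
    fun i hi => ((hadj _ _).mp (c.adj_getVert_succ hi)).2
  -- A subtree that meets both sides of the separating edge contains its end `a`.
  have ha : ∀ i, (C (c.getVert i) ∩ B).Nonempty → (C (c.getVert i) \ B).Nonempty →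
      a ∈ C (c.getVert i) := by
    intro i h1 h2
    obtain ⟨u, hu, v, hv, huv⟩ := hC _ _ h1 h2
    exact (hcr v hv.2 u hu.2 huv.symm).1 ▸ hv.1
  have h1 : a ∈ C (c.getVert 1) := by
    refine ha 1 ?_ ?_
    · obtain ⟨z, hz, hz'⟩ := hinter 1 (by omega)
      exact ⟨z, hz, h2B hz'⟩
    · obtain ⟨z, hz, hz'⟩ := hinter 0 (by omega)
      exact ⟨z, hz', fun h => Set.disjoint_left.mp h0B hz h⟩
  by_cases hj : ∃ j, 3 ≤ j ∧ j < c.length ∧ a ∈ C (c.getVert j)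
  · obtain ⟨j, h3, hjl, haj⟩ := hj
    exact chord 1 j (by omega) hjl (by omega) ⟨a, h1, haj⟩
  push Not at hj
  -- Without a chord from vertex 1, no later subtree contains `a`, so none can leave `B`; yet the
  -- last one must meet the subtree of vertex 0, which is disjoint from `B`.
  have hall : ∀ j, 2 ≤ j → j < c.length → C (c.getVert j) ⊆ B := by
    intro j h2
    induction j, h2 using Nat.le_induction with
    | base => exact fun _ => h2B
    | succ j h2 ih =>
      intro hjl
      obtain ⟨z, hz, hz'⟩ := hinter j (by omega)
      intro w hw
      by_contra hwB
      exact hj (j + 1) (by omega) hjl (ha _ ⟨z, hz', ih (by omega) hz⟩ ⟨w, hw, hwB⟩)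
  obtain ⟨z, hz, hz'⟩ := hinter (c.length - 1) (by omega)
  rw [show c.length - 1 + 1 = c.length by omega, Walk.getVert_length, ← c.getVert_zero] at hz'
  exact absurd (hall _ (by omega) (by omega) hz) (Set.disjoint_left.mp h0B hz')

end SimpleGraph

/-! ## Cuts of graph models -/

namespace HolographicGraphModel

variable {N : ℕ} {M : HolographicGraphModel N}

theorem isCut_iff {X : Subsystem N} {C : Set M.V} :
    M.IsCut X C ↔ ∀ b : M.boundary, b.1 ∈ C ↔ M.label b ∈ X := by
  constructor
  · intro h b
    have h1 := Set.ext_iff.mp h b.1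
    simp only [Set.mem_inter_iff, b.2, and_true, Set.mem_image, Set.mem_ofPred_eq] at h1
    rw [h1]
    exact ⟨fun ⟨x, hx, hxb⟩ => Subtype.ext hxb ▸ hx, fun h => ⟨b, h, rfl⟩⟩
  · intro h
    ext v
    simp only [Set.mem_inter_iff, Set.mem_image, Set.mem_ofPred_eq]
    exact ⟨fun ⟨h1, h2⟩ => ⟨⟨v, h2⟩, (h ⟨v, h2⟩).mp h1, rfl⟩,
      fun ⟨x, hx, hxb⟩ => hxb ▸ ⟨(h x).mpr hx, x.2⟩⟩

theorem IsCut.compl {X : Subsystem N} {C : Set M.V} (h : M.IsCut X C) : M.IsCut Xᶜ Cᶜ := by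
  rw [isCut_iff] at h ⊢
  intro b
  rw [Set.mem_compl_iff, Finset.mem_compl, h b]

theorem IsCut.union {X Y : Subsystem N} {C D : Set M.V} (hC : M.IsCut X C) (hD : M.IsCut Y D) :
    M.IsCut (X ∪ Y) (C ∪ D) := by
  rw [isCut_iff] at hC hD ⊢
  intro b
  rw [Set.mem_union, Finset.mem_union, hC b, hD b]

theorem IsCut.sdiff {X Y : Subsystem N} {C D : Set M.V} (hC : M.IsCut X C) (hD : M.IsCut Y D) :
    M.IsCut (X \ Y) (C \ D) := by
  rw [isCut_iff] at hC hD ⊢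
  intro b
  rw [Set.mem_sdiff, Finset.mem_sdiff, hC b, hD b]

theorem isCut_empty : M.IsCut ∅ ∅ := by
  simp [isCut_iff]

theorem mk_mem_cutEdges {C : Set M.V} {u v : M.V} :
    s(u, v) ∈ M.cutEdges C ↔ M.graph.Adj u v ∧ (u ∈ C ∧ v ∉ C ∨ v ∈ C ∧ u ∉ C) := by
  rw [cutEdges, Set.mem_ofPred_eq, SimpleGraph.mem_edgeSet]
  refine and_congr_right fun _ => ⟨?_, ?_⟩
  · rintro ⟨a, ha, b, hb, h⟩
    rcases Sym2.eq_iff.mp h with ⟨rfl, rfl⟩ | ⟨rfl, rfl⟩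
    · exact Or.inl ⟨ha, hb⟩
    · exact Or.inr ⟨ha, hb⟩
  · rintro (⟨h1, h2⟩ | ⟨h1, h2⟩)
    · exact ⟨u, h1, v, h2, rfl⟩
    · exact ⟨v, h1, u, h2, Sym2.eq_swap⟩

theorem cutEdges_compl (C : Set M.V) : M.cutEdges Cᶜ = M.cutEdges C := by
  ext e
  induction e with
  | h u v =>
    simp only [mk_mem_cutEdges, Set.mem_compl_iff]
    tauto

theorem cutEdges_empty : M.cutEdges ∅ = ∅ := by
  ext e
  induction e with
  | h u v => simp [mk_mem_cutEdges]

theorem cutEdges_symmDiff (C D : Set M.V) :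
    M.cutEdges (symmDiff C D) = symmDiff (M.cutEdges C) (M.cutEdges D) := by
  ext e
  induction e with
  | h u v =>
    simp only [mk_mem_cutEdges, Set.mem_symmDiff]
    by_cases u ∈ C <;> by_cases u ∈ D <;> by_cases v ∈ C <;> by_cases v ∈ D <;> simp_all

theorem cost_congr {C D : Set M.V} (h : M.cutEdges C = M.cutEdges D) : M.cost C = M.cost D := by
  unfold cost
  congr 1
  ext e
  simp [h]

theorem cost_compl (C : Set M.V) : M.cost Cᶜ = M.cost C := cost_congr (cutEdges_compl C)

theorem cost_empty : M.cost ∅ = 0 := by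
  unfold cost
  refine Finset.sum_eq_zero fun e he => ?_
  rw [Set.Finite.mem_toFinset, cutEdges_empty] at he
  exact he.elim

theorem cost_nonneg (C : Set M.V) : 0 ≤ M.cost C := by
  refine Finset.sum_nonneg fun e he => M.weight_nonneg e ?_
  rw [Set.Finite.mem_toFinset] at he
  exact he.1

/-- The two inclusions say that each edge is counted on the left at most as often as on the right.
-/
theorem cost_add_le {A B C D : Set M.V}
    (hu : M.cutEdges A ∪ M.cutEdges B ⊆ M.cutEdges C ∪ M.cutEdges D)
    (hi : M.cutEdges A ∩ M.cutEdges B ⊆ M.cutEdges C ∩ M.cutEdges D) :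
    M.cost A + M.cost B ≤ M.cost C + M.cost D := by
  classical
  unfold cost
  rw [← Finset.sum_union_inter, ← Finset.sum_union_inter (s₁ := (M.cutEdges_finite C).toFinset)]
  refine add_le_add (Finset.sum_le_sum_of_subset_of_nonneg ?_ ?_)
    (Finset.sum_le_sum_of_subset_of_nonneg ?_ ?_)
  · intro e he
    simpa using hu (by simpa using he)
  · intro e he _
    refine M.weight_nonneg e ?_
    rw [Finset.mem_union, Set.Finite.mem_toFinset, Set.Finite.mem_toFinset] at he
    exact he.elim (fun h => h.1) (fun h => h.1)
  · intro e he
    simpa using hi (by simpa using he)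
  · intro e he _
    refine M.weight_nonneg e ?_
    rw [Finset.mem_inter, Set.Finite.mem_toFinset] at he
    exact he.1.1

theorem cost_union_le (C D : Set M.V) : M.cost (C ∪ D) ≤ M.cost C + M.cost D := by
  have h : M.cost (C ∪ D) + M.cost ∅ ≤ M.cost C + M.cost D := by
    refine cost_add_le ?_ ?_
    · rw [cutEdges_empty, Set.union_empty]
      intro e
      induction e with
      | h u v =>
        simp only [Set.mem_union, mk_mem_cutEdges]
        tauto
    · simp [cutEdges_empty]
  rwa [cost_empty, add_zero] at h

theorem cost_sdiff_add_cost_sdiff_le (C D : Set M.V) :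
    M.cost (C \ D) + M.cost (D \ C) ≤ M.cost C + M.cost D := by
  refine cost_add_le ?_ ?_
  all_goals
    intro e
    induction e with
    | h u v =>
      simp only [Set.mem_union, Set.mem_inter_iff, Set.mem_sdiff, mk_mem_cutEdges]
      tauto

/-- Cutting a region along a set without edges across does not change the total cost. -/
theorem cost_inter_add_cost_sdiff_le {C A : Set M.V}
    (h : ∀ u ∈ C ∩ A, ∀ v ∈ C \ A, ¬ M.graph.Adj u v) :
    M.cost (C ∩ A) + M.cost (C \ A) ≤ M.cost C := by
  rw [← add_zero (M.cost C), ← cost_empty (M := M)]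
  refine cost_add_le ?_ ?_
  all_goals
    rw [cutEdges_empty]
    intro e
    induction e with
    | h u v =>
      have h1 : u ∈ C ∩ A → v ∈ C \ A → ¬ M.graph.Adj u v := fun hu => h u hu v
      have h2 : v ∈ C ∩ A → u ∈ C \ A → ¬ M.graph.Adj v u := fun hv => h v hv u
      have h3 := M.graph.adj_comm u v
      simp only [Set.mem_union, Set.mem_inter_iff, Set.mem_sdiff, mk_mem_cutEdges,
        Set.mem_empty_iff_false] at *
      tauto

/-- The graph model computes the set function `f` by minimizing over cuts. -/
def Computes (M : HolographicGraphModel N) (f : Subsystem N → ℝ) : Prop :=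
  ∀ X, (∃ C, M.IsCut X C ∧ M.cost C = f X) ∧ ∀ C, M.IsCut X C → f X ≤ M.cost C

/-- An inclusion-minimal min-cut. -/
def IsLeastCut (M : HolographicGraphModel N) (f : Subsystem N → ℝ) (X : Subsystem N)
    (C : Set M.V) : Prop :=
  Minimal (fun C => M.IsCut X C ∧ M.cost C ≤ f X) C

theorem Computes.exists_isLeastCut {f : Subsystem N → ℝ} (h : M.Computes f) (X : Subsystem N) :
    ∃ C, M.IsLeastCut f X C := by
  have := M.finite_V
  obtain ⟨C, hC, hc⟩ := (h X).1
  obtain ⟨D, -, hD⟩ := Finite.exists_le_minimal (p := fun C => M.IsCut X C ∧ M.cost C ≤ f X)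
    (a := C) ⟨hC, hc.le⟩
  exact ⟨D, hD⟩

/-- `C \ D` and `D \ C` are again cuts for `X` and `Y`, at no greater total cost. So `C \ D` is
optimal, and minimality of `C` gives `C ⊆ C \ D`. -/
theorem Computes.disjoint_of_isLeastCut {f : Subsystem N → ℝ} (h : M.Computes f)
    {X Y : Subsystem N} {C D : Set M.V} (hC : M.IsLeastCut f X C) (hD : M.IsLeastCut f Y D)
    (hXY : Disjoint X Y) : Disjoint C D := by
  have h1 := hC.prop.1.sdiff hD.prop.1
  have h2 := hD.prop.1.sdiff hC.prop.1
  rw [Finset.sdiff_eq_self_of_disjoint hXY] at h1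
  rw [Finset.sdiff_eq_self_of_disjoint hXY.symm] at h2
  have h3 := cost_sdiff_add_cost_sdiff_le C D
  have h4 := (h Y).2 _ h2
  have h5 := hC.prop.2
  have h6 := hD.prop.2
  have h7 : C ⊆ C \ D := hC.le_of_le ⟨h1, by linarith⟩ Set.sdiff_subset
  exact Set.disjoint_left.mpr fun a ha => (h7 ha).2

theorem Computes.isIndecomposable_of_isLeastCut {f : Subsystem N → ℝ} (h : M.Computes f)
    (hf : IsPureEntropy f) (hM : M.IsSimple) {X : Subsystem N} (hX : IsCorrelated f X)
    {C : Set M.V} (hC : M.IsLeastCut f X C) : M.graph.IsIndecomposable C := by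
  classical
  intro A h1 h2
  by_contra! hno
  -- `Y` collects the parties of `X` placed in `A`. As each party has a single boundary vertex, `C ∩
  -- A` and `C \ A` are cuts for `Y` and `X \ Y`.
  set Y : Subsystem N := {p ∈ X | ∃ b, M.label b = p ∧ b.1 ∈ A} with hYdef
  have hcut := isCut_iff.mp hC.prop.1
  have hmem : ∀ b, M.label b ∈ Y ↔ M.label b ∈ X ∧ b.1 ∈ A := by
    intro b
    rw [hYdef, Finset.mem_filter]
    exact and_congr_right fun _ => ⟨fun ⟨b', hb, hA⟩ => hM hb ▸ hA, fun hA => ⟨b, rfl, hA⟩⟩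
  have hYX : Y ⊆ X := Finset.filter_subset _ _
  have hY : M.IsCut Y (C ∩ A) := isCut_iff.mpr fun b => by
    rw [hmem, Set.mem_inter_iff, hcut]
  have hZ : M.IsCut (X \ Y) (C \ A) := isCut_iff.mpr fun b => by
    rw [Finset.mem_sdiff, hmem, Set.mem_sdiff, hcut]
    tauto
  have hc := cost_inter_add_cost_sdiff_le hno
  have hd : Disjoint Y (X \ Y) := Finset.disjoint_sdiff
  have hu : Y ∪ X \ Y = X := Finset.union_sdiff_of_subset hYX
  have h3 := hf.union_le hd
  rw [hu] at h3
  have h4 := (h _).2 _ hY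
  have h5 := (h _).2 _ hZ
  have h6 := hC.prop.2
  -- A piece without boundary vertices could be dropped from `C`, against minimality.
  rcases Y.eq_empty_or_nonempty with h0 | hYn
  · rw [h0, Finset.sdiff_empty] at hZ
    obtain ⟨a, ha⟩ := h1
    have h7 : C ⊆ C \ A := hC.le_of_le ⟨hZ, by have := M.cost_nonneg (C ∩ A); linarith⟩
      Set.sdiff_subset
    exact (h7 ha.1).2 ha.2
  rcases (X \ Y).eq_empty_or_nonempty with h0 | hZn
  · have h8 : Y = X := hYX.antisymm (Finset.sdiff_eq_empty_iff_subset.mp h0)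
    rw [h8] at hY
    obtain ⟨a, ha⟩ := h2
    have h7 : C ⊆ C ∩ A := hC.le_of_le ⟨hY, by have := M.cost_nonneg (C \ A); linarith⟩
      Set.inter_subset_left
    exact ha.2 (h7 ha.1).2
  exact hX.2 Y (X \ Y) hYn hZn hd hu (by linarith)

end HolographicGraphModel

/-! ## Entropies of irreducible entropy vectors -/

namespace EntropyVector

variable {N : ℕ} {S : EntropyVector N}

theorem ent_coe (S : EntropyVector N) (X : {X : Subsystem N // X.Nonempty ∧ (0 : Party N) ∉ X}) :
    S.ent X.1 = S X := by
  rw [ent, dif_pos X.2]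

theorem ent_empty (S : EntropyVector N) : S.ent ∅ = 0 := by
  rw [ent, dif_neg (by simp), dif_neg (by simp)]

theorem ent_compl (S : EntropyVector N) (X : Subsystem N) : S.ent Xᶜ = S.ent X := by
  unfold ent
  by_cases h0 : (0 : Party N) ∈ X
  · have h1 : ¬ (X.Nonempty ∧ (0 : Party N) ∉ X) := fun h => h.2 h0
    rw [dif_neg h1]
    by_cases h2 : Xᶜ.Nonempty ∧ (0 : Party N) ∉ Xᶜ
    · rw [dif_pos h2, dif_pos h2]
    · rw [dif_neg h2, dif_neg h2, dif_neg (by rwa [compl_compl])]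
  · have h1 : ¬ (Xᶜ.Nonempty ∧ (0 : Party N) ∉ Xᶜ) := fun h => h.2 (Finset.mem_compl.mpr h0)
    rw [dif_neg h1, dif_neg h1]
    simp only [compl_compl]

theorem IsIrreducible.isPureEntropy (hS : S.IsIrreducible) : IsPureEntropy S.ent := by
  have hsa : ∀ Y Z : Subsystem N, Disjoint Y Z → S.ent (Y ∪ Z) ≤ S.ent Y + S.ent Z := by
    intro Y Z hd
    rcases Y.eq_empty_or_nonempty with rfl | hY
    · simp [S.ent_empty]
    rcases Z.eq_empty_or_nonempty with rfl | hZ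
    · simp [S.ent_empty]
    have := hS.sa (Y, Z) ⟨hY, hZ, hd⟩
    simp only [mutualInfo] at this
    linarith
  refine ⟨S.ent_empty, S.ent_compl, fun X Y => ?_, fun X hX hXc => ?_⟩
  · rcases (X ∩ Y).eq_empty_or_nonempty with h | h
    · rw [h, S.ent_empty, add_zero]
      exact hsa X Y (Finset.disjoint_iff_inter_eq_empty.mpr h)
    rcases (X \ Y).eq_empty_or_nonempty with h1 | h1
    · have h2 := Finset.sdiff_eq_empty_iff_subset.mp h1
      rw [Finset.union_eq_right.mpr h2, Finset.inter_eq_left.mpr h2, add_comm]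
    rcases (Y \ X).eq_empty_or_nonempty with h2 | h2
    · have h3 := Finset.sdiff_eq_empty_iff_subset.mp h2
      rw [Finset.union_eq_left.mpr h3, Finset.inter_eq_right.mpr h3]
    -- Submodularity is SSA for these three parts; SSA requires them non-empty, hence the degenerate
    -- cases above.
    have h4 := hS.ssa (X \ Y) (X ∩ Y) (Y \ X) h1 h h2
      (Finset.disjoint_left.mpr (by grind)) (Finset.disjoint_left.mpr (by grind))
      (Finset.disjoint_left.mpr (by grind))
    have e1 : X \ Y ∪ X ∩ Y = X := by grind
    have e2 : X ∩ Y ∪ Y \ X = Y := by grind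
    have e3 : X \ Y ∪ Y = X ∪ Y := by grind
    simp only [mutualInfo, e1, e2, e3] at h4
    linarith
  · have h1 := hsa X Xᶜ disjoint_compl_right
    rw [Finset.union_compl, ← Finset.compl_empty, S.ent_compl, S.ent_compl, S.ent_empty] at h1
    refine lt_of_le_of_ne (by linarith) (Ne.symm ?_)
    by_cases h0 : (0 : Party N) ∈ X
    · rw [← S.ent_compl, S.ent_coe ⟨Xᶜ, hXc, by simpa using h0⟩]
      exact hS.ne_zero _
    · rw [S.ent_coe ⟨X, hX, h0⟩]
      exact hS.ne_zero _

theorem isPositive_iff (S : EntropyVector N) {X : Subsystem N} :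
    S.IsPositive X ↔ ∀ Y Z : Subsystem N, Y.Nonempty → Z.Nonempty → Disjoint Y Z → Y ∪ Z = X →
      S.ent Y + S.ent Z ≠ S.ent X := by
  constructor
  · rintro h Y Z hY hZ hd rfl he
    have hm : (Y, Z) ∈ miInstances N := ⟨hY, hZ, hd⟩
    exact (h ⟨hm, rfl⟩).2 ⟨hm, by simp only [mutualInfo]; linarith⟩
  · rintro h ⟨Y, Z⟩ ⟨hm, he⟩
    refine ⟨hm, fun h' => h Y Z hm.1 hm.2.1 hm.2.2 he ?_⟩
    have := h'.2
    rw [← he]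
    simp only [mutualInfo] at this ⊢
    linarith

theorem mem_edgeSet_iff (S : EntropyVector N) {e : Set (Party N)} :
    e ∈ S.correlationHypergraph.edgeSet ↔
      ∃ X : Subsystem N, 2 ≤ X.card ∧ IsCorrelated S.ent X ∧ (X : Set (Party N)) = e := by
  constructor
  · rintro ⟨X, ⟨h2, hX⟩, rfl⟩
    exact ⟨X, h2, ⟨Finset.card_pos.mp (by omega), S.isPositive_iff.mp hX⟩, rfl⟩
  · rintro ⟨X, h2, hX, rfl⟩
    exact ⟨X, ⟨h2, S.isPositive_iff.mpr hX.2⟩, rfl⟩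

end EntropyVector

open HolographicGraphModel in
-- Complementing a cut preserves its cost, which settles the subsystems containing the purifier.
theorem HolographicGraphModel.Realizes.computes {N : ℕ} {S : EntropyVector N}
    {M : HolographicGraphModel N} (h : M.Realizes S) : M.Computes S.ent := by
  have key : ∀ X : Subsystem N, (0 : Party N) ∉ X →
      (∃ C, M.IsCut X C ∧ M.cost C = S.ent X) ∧ ∀ C, M.IsCut X C → S.ent X ≤ M.cost C := by
    intro X h0
    rcases X.eq_empty_or_nonempty with rfl | hX
    · exact ⟨⟨∅, isCut_empty, by rw [cost_empty, S.ent_empty]⟩,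
        fun C _ => by rw [S.ent_empty]; exact M.cost_nonneg C⟩
    · obtain ⟨C, ⟨hC, hmin⟩, hc⟩ := h ⟨X, hX, h0⟩
      rw [← S.ent_coe] at hc
      exact ⟨⟨C, hC, hc⟩, fun D hD => hc ▸ hmin D hD⟩
  intro X
  by_cases h0 : (0 : Party N) ∈ X
  · obtain ⟨⟨C, hC, hc⟩, hmin⟩ := key Xᶜ (by simpa using h0)
    rw [S.ent_compl] at hc hmin
    refine ⟨⟨Cᶜ, ?_, by rw [cost_compl, hc]⟩, fun D hD => ?_⟩
    · simpa using hC.compl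
    · rw [← cost_compl]
      exact hmin _ hD.compl
  · exact key X h0

theorem EntropyVector.IsIrreducible.isChordalGraph_lineGraph {N : ℕ} {S : EntropyVector N}
    (hS : S.IsIrreducible) {M : HolographicGraphModel N} (hM : M.IsSimpleTree)
    (hR : M.Realizes S) : S.lineGraph.IsChordalGraph := by
  have hf := hS.isPureEntropy
  have hc := hR.computes
  choose X _ hX hXe using fun e : S.correlationHypergraph.edgeSet => S.mem_edgeSet_iff.mp e.2
  choose C hC using hc.exists_isLeastCut
  have hmem : ∀ (Y : Subsystem N) (p : Party N), p ∈ Y → ∃ b : M.boundary, M.label b = p ∧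
      b.1 ∈ C Y := by
    intro Y p hp
    obtain ⟨b, rfl⟩ := M.label_surjective p
    exact ⟨b, rfl, (HolographicGraphModel.isCut_iff.mp (hC Y).prop.1 b).mpr hp⟩
  refine SimpleGraph.isChordalGraph_of_subtrees hM.2 (fun e => C (X e))
    (fun e => hc.isIndecomposable_of_isLeastCut hf hM.1 (hX e) (hC (X e))) ?_ ?_
  · intro e
    obtain ⟨p, hp⟩ := (hX e).1
    obtain ⟨b, -, hb⟩ := hmem _ p hp
    exact ⟨_, hb⟩
  · intro e e'
    refine and_congr_right fun _ => ⟨?_, ?_⟩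
    · rintro ⟨p, hp, hp'⟩
      rw [← hXe, Finset.mem_coe] at hp hp'
      obtain ⟨b, rfl, hb⟩ := hmem _ p hp
      exact ⟨b.1, hb, (HolographicGraphModel.isCut_iff.mp (hC (X e')).prop.1 b).mpr hp'⟩
    · intro hn
      rw [← hXe, ← hXe, ← Set.not_disjoint_iff_nonempty_inter, Finset.disjoint_coe]
      exact fun hd => Set.not_disjoint_iff_nonempty_inter.mpr hn
        (hc.disjoint_of_isLeastCut (hC _) (hC _) hd)

/-! ## Trees from laminar families -/

namespace SimpleGraph

variable {V : Type*} [PartialOrder V]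

/-- In an order whose principal upper sets are chains, an edge of the Hasse diagram which leaves a
principal lower set starts at its greatest element. -/
theorem hasse_adj_leaving_Iic (hV : ∀ a b c : V, c ≤ a → c ≤ b → a ≤ b ∨ b ≤ a) {k u v : V}
    (h : (hasse V).Adj u v) (hu : u ≤ k) (hv : ¬ v ≤ k) : u = k ∧ k ⋖ v := by
  rw [hasse_adj] at h
  rcases h with h | h
  · have hkv : k < v := by
      rcases hV k v u hu h.le with h1 | h1
      · exact lt_of_le_of_ne h1 fun e => hv e.ge
      · exact absurd h1 hv
    have huk : u = k := by
      by_contra hne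
      exact h.2 (lt_of_le_of_ne hu hne) hkv
    exact ⟨huk, huk ▸ h⟩
  · exact absurd (h.le.trans hu) hv

theorem covBy_right_unique (hV : ∀ a b c : V, c ≤ a → c ≤ b → a ≤ b ∨ b ≤ a) {k u v : V}
    (hu : k ⋖ u) (hv : k ⋖ v) : u = v := by
  rcases hV u v k hu.le hv.le with h | h
  · by_contra hne
    exact hv.2 hu.lt (lt_of_le_of_ne h hne)
  · by_contra hne
    exact hu.2 hv.lt (lt_of_le_of_ne h (Ne.symm hne))

/-- Climbing covers reaches the top, which gives connectedness. Every edge `v ⋖ w` is a bridge,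
being the only edge that leaves the lower set of `v`. -/
theorem isTree_hasse [Finite V] [OrderTop V]
    (hV : ∀ a b c : V, c ≤ a → c ≤ b → a ≤ b ∨ b ≤ a) : (hasse V).IsTree := by
  have hreach : ∀ a : V, (hasse V).Reachable a ⊤ := by
    intro a
    induction a using WellFoundedGT.induction with
    | ind a ih =>
      rcases eq_or_ne a ⊤ with rfl | ha
      · exact Reachable.refl _
      · obtain ⟨b, hb, -⟩ := exists_covBy_le_of_lt (lt_top_iff_ne_top.mpr ha)
        exact (Adj.reachable (Or.inl hb)).trans (ih b hb.lt)
  have hsub : ∀ {v w x y : V}, v ⋖ w → ((hasse V).deleteEdges {s(v, w)}).Walk x y → x ≤ v →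
      y ≤ v := by
    intro v w x y hvw p
    induction p with
    | nil => exact id
    | @cons x z y h p ih =>
      intro hx
      refine ih ?_
      by_contra hz
      rw [deleteEdges_adj] at h
      obtain ⟨rfl, h1⟩ := hasse_adj_leaving_Iic hV h.1 hx hz
      exact h.2 (by rw [covBy_right_unique hV h1 hvw]; rfl)
  have hbridge : ∀ {v w : V}, v ⋖ w → (hasse V).IsBridge s(v, w) := by
    intro v w hvw
    rw [isBridge_iff]
    rintro ⟨p⟩
    exact hvw.lt.not_ge (hsub hvw p le_rfl)
  refine ⟨{ preconnected := fun a b => (hreach a).trans (hreach b).symm, nonempty := ⟨⊤⟩ }, ?_⟩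
  rw [isAcyclic_iff_forall_adj_isBridge]
  rintro v w (h | h)
  · exact hbridge h
  · rw [Sym2.eq_swap]
    exact hbridge h

theorem IsChordalGraph.not_four_cycle {V : Type*} {G : SimpleGraph V} (hG : G.IsChordalGraph)
    {a b c d : V} (hab : G.Adj a b) (hbc : G.Adj b c) (hcd : G.Adj c d) (hda : G.Adj d a)
    (hac : a ≠ c) (hbd : b ≠ d) (hac' : ¬ G.Adj a c) (hbd' : ¬ G.Adj b d) : False := by
  have hcyc : (Walk.cons hab (.cons hbc (.cons hcd (.cons hda .nil)))).IsCycle := by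
    have h1 := hab.ne
    have h2 := hbc.ne
    have h3 := hcd.ne
    have h4 := hda.ne
    rw [Walk.cons_isCycle_iff]
    simp only [Walk.cons_isPath_iff, Walk.support_cons, Walk.support_nil, Walk.edges_cons,
      Walk.edges_nil, List.mem_cons, List.not_mem_nil, Walk.isPath_iff_nil, Sym2.eq_iff]
    grind
  obtain ⟨x, hx, y, hy, hxy, hne⟩ := hG _ _ hcyc (by simp)
  have hac'' := fun h => hac' (G.adj_symm h)
  have hbd'' := fun h => hbd' (G.adj_symm h)
  simp only [Walk.support_cons, Walk.support_nil, Walk.edges_cons,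
      Walk.edges_nil, List.mem_cons, List.not_mem_nil, Sym2.eq_iff] at hx hy hne
  have hl := G.irrefl (v := x)
  grind

end SimpleGraph

/-- A laminar family of sets of parties which contains the singletons of all parties other than
the purifier, and whose members are non-empty and do not contain the purifier. -/
structure IsRootedLaminar {N : ℕ} (F : Subsystem N → Prop) : Prop where
  nonempty : ∀ K, F K → K.Nonempty
  zero_notMem : ∀ K, F K → (0 : Party N) ∉ K
  singleton : ∀ p : Party N, p ≠ 0 → F {p}
  laminar : ∀ J K, F J → F K → (J ∩ K).Nonempty → J ⊆ K ∨ K ⊆ J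

namespace IsRootedLaminar

variable {N : ℕ} {F : Subsystem N → Prop} {f : Subsystem N → ℝ}

/-- The vertices of the tree of a laminar family: its members and the root. -/
abbrev Node (F : Subsystem N → Prop) : Type := {K : Subsystem N // F K ∨ K = Finset.univ}

instance : OrderTop (Node F) where
  top := ⟨Finset.univ, Or.inr rfl⟩
  le_top K := Finset.subset_univ K.1

theorem node_chain (hF : IsRootedLaminar F) (a b c : Node F) (ha : c ≤ a) (hb : c ≤ b) :
    a ≤ b ∨ b ≤ a := by
  rcases a.2 with ha' | ha'
  · rcases b.2 with hb' | hb'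
    · have hc : c.1.Nonempty := by
        rcases c.2 with hc | hc
        · exact hF.nonempty _ hc
        · rw [hc]
          exact Finset.univ_nonempty
      obtain ⟨p, hp⟩ := hc
      exact hF.laminar _ _ ha' hb' ⟨p, Finset.mem_inter.mpr ⟨ha hp, hb hp⟩⟩
    · exact Or.inl (show a.1 ⊆ b.1 by rw [hb']; exact Finset.subset_univ _)
  · exact Or.inr (show b.1 ⊆ a.1 by rw [ha']; exact Finset.subset_univ _)

open Classical in
/-- The node of a party: the root for the purifier, and a singleton otherwise. -/
noncomputable def partyNode (hF : IsRootedLaminar F) (p : Party N) : Node F :=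
  if h : p = 0 then ⊤ else ⟨{p}, Or.inl (hF.singleton p h)⟩

theorem partyNode_le_iff (hF : IsRootedLaminar F) {p : Party N} {K : Subsystem N} (hK : F K) :
    hF.partyNode p ≤ ⟨K, Or.inl hK⟩ ↔ p ∈ K := by
  have h0 := hF.zero_notMem K hK
  unfold partyNode
  split_ifs with h
  · subst h
    exact ⟨fun h => h (Finset.mem_univ _), fun h => absurd h h0⟩
  · exact Finset.singleton_subset_iff

theorem partyNode_injective (hF : IsRootedLaminar F) : Function.Injective hF.partyNode := by
  intro p q h
  by_cases hp : p = 0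
  · by_cases hq : q = 0
    · rw [hp, hq]
    · have h1 := (hF.partyNode_le_iff (p := p) (hF.singleton q hq)).mp (by
        rw [h, hF.partyNode_le_iff (hF.singleton q hq)]; exact Finset.mem_singleton_self q)
      exact Finset.mem_singleton.mp h1
  · have h1 := (hF.partyNode_le_iff (p := q) (hF.singleton p hp)).mp (by
      rw [← h, hF.partyNode_le_iff (hF.singleton p hp)]; exact Finset.mem_singleton_self p)
    exact (Finset.mem_singleton.mp h1).symm

/-- The tree of a laminar family as a graph model: the edge between a member of the family and its
parent is weighted by the entropy of the member. -/
noncomputable abbrev treeModel (hF : IsRootedLaminar F) (hf : IsPureEntropy f) :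
    HolographicGraphModel N where
  V := Node F
  finite_V := inferInstance
  graph := SimpleGraph.hasse (Node F)
  -- The intersection makes the weight symmetric; on an edge it is the smaller set.
  weight := Sym2.lift ⟨fun J K => f (J.1 ∩ K.1), fun J K => congrArg f (Finset.inter_comm J.1 K.1)⟩
  weight_nonneg e _ := by
    induction e with
    | h J K => exact hf.nonneg _
  boundary := Set.range hF.partyNode
  label := (Equiv.ofInjective _ hF.partyNode_injective).symm
  label_surjective := Equiv.surjective _

variable (hF : IsRootedLaminar F) (hf : IsPureEntropy f)

theorem isSimpleTree_treeModel : (hF.treeModel hf).IsSimpleTree :=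
  ⟨Equiv.injective (Equiv.ofInjective _ hF.partyNode_injective).symm,
    SimpleGraph.isTree_hasse hF.node_chain⟩

theorem isCut_treeModel_iff {X : Subsystem N} {C : Set (hF.treeModel hf).V} :
    (hF.treeModel hf).IsCut X C ↔ ∀ p, hF.partyNode p ∈ C ↔ p ∈ X := by
  rw [HolographicGraphModel.isCut_iff]
  constructor
  · intro h p
    have h1 := h (Equiv.ofInjective _ hF.partyNode_injective p)
    have h2 : (hF.treeModel hf).label (Equiv.ofInjective _ hF.partyNode_injective p) = p :=
      Equiv.symm_apply_apply _ p
    rwa [h2] at h1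
  · rintro h ⟨_, p, rfl⟩
    have h2 : (hF.treeModel hf).label ⟨hF.partyNode p, p, rfl⟩ = p :=
      Equiv.symm_apply_apply (Equiv.ofInjective _ hF.partyNode_injective) p
    rw [h2]
    exact h p

theorem isCut_Iic {K : Subsystem N} (hK : F K) :
    (hF.treeModel hf).IsCut K (Set.Iic (⟨K, Or.inl hK⟩ : Node F)) :=
  (hF.isCut_treeModel_iff hf).mpr fun _ => hF.partyNode_le_iff hK

theorem cutEdges_Iic {K L : Node F} (h : K ⋖ L) :
    (hF.treeModel hf).cutEdges (Set.Iic K) = {s(K, L)} := by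
  have key : ∀ {u v : Node F}, (SimpleGraph.hasse (Node F)).Adj u v → u ≤ K → ¬ v ≤ K →
      u = K ∧ v = L := fun huv hu hv => by
    obtain ⟨h1, h2⟩ := SimpleGraph.hasse_adj_leaving_Iic hF.node_chain huv hu hv
    exact ⟨h1, SimpleGraph.covBy_right_unique hF.node_chain h2 h⟩
  ext e
  induction e with
  | h u v =>
    rw [HolographicGraphModel.mk_mem_cutEdges, Set.mem_singleton_iff, Sym2.eq_iff]
    constructor
    · rintro ⟨huv, ⟨h1, h2⟩ | ⟨h1, h2⟩⟩
      · exact Or.inl (key huv h1 h2)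
      · exact Or.inr (key huv.symm h1 h2).symm
    · rintro (⟨rfl, rfl⟩ | ⟨rfl, rfl⟩)
      · exact ⟨Or.inl h, Or.inl ⟨Set.self_mem_Iic, h.lt.not_ge⟩⟩
      · exact ⟨Or.inr h, Or.inr ⟨Set.self_mem_Iic, h.lt.not_ge⟩⟩

theorem weight_mk {K L : Node F} (h : K ⋖ L) : (hF.treeModel hf).weight s(K, L) = f K.1 :=
  congrArg f (Finset.inter_eq_left.mpr h.le)

theorem exists_isCut_cost_le {K : Subsystem N} (hK : F K) :
    ∃ C, (hF.treeModel hf).IsCut K C ∧ (hF.treeModel hf).cost C ≤ f K := by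
  refine ⟨_, hF.isCut_Iic hf hK, ?_⟩
  have hlt : (⟨K, Or.inl hK⟩ : Node F) < ⊤ := by
    rw [lt_top_iff_ne_top]
    intro h
    have h1 : K = Finset.univ := congrArg Subtype.val h
    exact hF.zero_notMem K hK (h1 ▸ Finset.mem_univ _)
  obtain ⟨L, hL, -⟩ := exists_covBy_le_of_lt hlt
  have h : ((hF.treeModel hf).cutEdges_finite (Set.Iic (⟨K, Or.inl hK⟩ : Node F))).toFinset =
      {s(⟨K, Or.inl hK⟩, L)} := by
    ext e
    rw [Set.Finite.mem_toFinset, hF.cutEdges_Iic hf hL, Finset.mem_singleton,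
      Set.mem_singleton_iff]
  rw [HolographicGraphModel.cost, h, Finset.sum_singleton, hF.weight_mk hf hL]

/-- Toggling a cut by the branch below one of its cut edges removes exactly that edge. The cost
drops by `f K`, and `f` drops by at most `f K`, by `symmDiff_le`. -/
theorem le_cost_of_isCut {X : Subsystem N} {C : Set (hF.treeModel hf).V}
    (hC : (hF.treeModel hf).IsCut X C) : f X ≤ (hF.treeModel hf).cost C := by
  classical
  induction hn : ((hF.treeModel hf).cutEdges_finite C).toFinset.card generalizing X C with
  | zero =>
    -- The tree is connected, so a cut without cut edges is empty or everything, and `f X = 0`.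
    refine le_of_eq_of_le ?_ (HolographicGraphModel.cost_nonneg C)
    have hno : ∀ {u v : (hF.treeModel hf).V}, (hF.treeModel hf).graph.Walk u v → u ∈ C →
        v ∈ C := by
      intro u v p
      induction p with
      | nil => exact id
      | cons h p ih =>
        intro hu
        refine ih ?_
        by_contra hz
        have := Finset.card_eq_zero.mp hn
        rw [Set.Finite.toFinset_eq_empty] at this
        exact this.le (HolographicGraphModel.mk_mem_cutEdges.mpr ⟨h, Or.inl ⟨hu, hz⟩⟩)
    have hconn := (hF.isSimpleTree_treeModel hf).2.connected.preconnected
    rw [isCut_treeModel_iff] at hC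
    rcases X.eq_empty_or_nonempty with rfl | ⟨p, hp⟩
    · exact hf.empty
    · have hX : X = Finset.univ := by
        ext q
        obtain ⟨w⟩ := hconn (hF.partyNode p) (hF.partyNode q)
        simpa using (hC q).mp (hno w ((hC p).mpr hp))
      rw [hX, ← Finset.compl_empty, hf.compl, hf.empty]
  | succ n ih =>
    obtain ⟨e, he⟩ := Finset.card_pos.mp (by rw [hn]; exact n.succ_pos)
    have hcov : ∃ K L : Node F, K ⋖ L ∧ e = s(K, L) := by
      rw [Set.Finite.mem_toFinset] at he
      have h1 := he.1
      induction e with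
      | h u v =>
        rcases h1 with h | h
        · exact ⟨u, v, h, rfl⟩
        · exact ⟨v, u, h, Sym2.eq_swap⟩
    obtain ⟨K, L, hKL, rfl⟩ := hcov
    have hK : F K.1 := by
      refine K.2.resolve_right fun h => ?_
      have h1 : L ≤ K := show L.1 ⊆ K.1 by rw [h]; exact Finset.subset_univ _
      exact hKL.lt.not_ge h1
    have hI := cutEdges_Iic hF hf hKL
    set D : Set (hF.treeModel hf).V := symmDiff C (Set.Iic K) with hD
    have hDcut : (hF.treeModel hf).IsCut (symmDiff X K.1) D := by
      have h1 := hF.isCut_Iic hf hK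
      rw [isCut_treeModel_iff] at hC h1 ⊢
      intro p
      rw [hD, Set.mem_symmDiff, Finset.mem_symmDiff, hC, ← h1 p]
    have hedges : ((hF.treeModel hf).cutEdges_finite D).toFinset =
        ((hF.treeModel hf).cutEdges_finite C).toFinset.erase s(K, L) := by
      rw [Set.Finite.mem_toFinset] at he
      ext e
      rw [Finset.mem_erase, Set.Finite.mem_toFinset, Set.Finite.mem_toFinset, hD,
        HolographicGraphModel.cutEdges_symmDiff, hI, Set.mem_symmDiff, Set.mem_singleton_iff]
      have h2 : e = s(K, L) → e ∈ (hF.treeModel hf).cutEdges C := fun h => h ▸ he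
      tauto
    have hle := ih hDcut (by rw [hedges, Finset.card_erase_of_mem he, hn]; rfl)
    have hcost : (hF.treeModel hf).cost C = (hF.treeModel hf).cost D + f K.1 := by
      rw [HolographicGraphModel.cost, HolographicGraphModel.cost, hedges, ← hF.weight_mk hf hKL,
        Finset.sum_erase_add _ _ he]
    have h3 := hf.symmDiff_le (symmDiff X K.1) K.1
    rw [symmDiff_symmDiff_cancel_right] at h3
    linarith

/-- If the family contains one side of each correlated set with correlated complement, then its
tree computes the entropy. -/
theorem computes_treeModel
    (h : ∀ K, IsCorrelated f K → IsCorrelated f Kᶜ → (0 : Party N) ∉ K → F K) :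
    (hF.treeModel hf).Computes f := by
  have key : ∀ X, ∃ C, (hF.treeModel hf).IsCut X C ∧ (hF.treeModel hf).cost C ≤ f X := by
    have hcompl : ∀ X, (∃ C, (hF.treeModel hf).IsCut X C ∧ (hF.treeModel hf).cost C ≤ f X) →
        ∃ C, (hF.treeModel hf).IsCut Xᶜ C ∧ (hF.treeModel hf).cost C ≤ f Xᶜ := by
      rintro X ⟨C, hC, hc⟩
      exact ⟨Cᶜ, hC.compl, by rwa [HolographicGraphModel.cost_compl, hf.compl]⟩
    refine hf.induction_on ⟨∅, HolographicGraphModel.isCut_empty, ?_⟩ hcompl ?_ ?_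
    · rw [HolographicGraphModel.cost_empty, hf.empty]
    · rintro Y Z - he ⟨C, hC, hc⟩ ⟨D, hD, hd⟩
      refine ⟨C ∪ D, hC.union hD, ?_⟩
      have := HolographicGraphModel.cost_union_le C D
      linarith
    · intro K hK hK'
      by_cases h0 : (0 : Party N) ∈ K
      · rw [← compl_compl K] at hK ⊢
        exact hcompl _ (hF.exists_isCut_cost_le hf (h _ hK' hK (by simpa using h0)))
      · exact hF.exists_isCut_cost_le hf (h K hK hK' h0)
  intro X
  obtain ⟨C, hC, hc⟩ := key X
  exact ⟨⟨C, hC, hc.antisymm (hF.le_cost_of_isCut hf hC)⟩, fun D hD => hF.le_cost_of_isCut hf hD⟩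

end IsRootedLaminar

theorem HolographicGraphModel.Computes.realizes {N : ℕ} {S : EntropyVector N}
    {M : HolographicGraphModel N} (h : M.Computes S.ent) : M.Realizes S := by
  intro X
  obtain ⟨⟨C, hC, hc⟩, hmin⟩ := h X.1
  exact ⟨C, ⟨hC, fun D hD => hc ▸ hmin D hD⟩, by rw [hc, S.ent_coe]⟩

namespace EntropyVector

variable {N : ℕ} {S : EntropyVector N}

/-- For an irreducible entropy vector, the complement of a party is correlated. -/
theorem IsIrreducible.isCorrelated_compl_singleton (hS : S.IsIrreducible) {p : Party N}
    (hp : ({p} : Subsystem N)ᶜ.Nonempty) : IsCorrelated S.ent {p}ᶜ := by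
  have hf := hS.isPureEntropy
  refine ⟨hp, fun Y Z hY hZ hd hu he => ?_⟩
  -- The hyperedges through `p` form a clique. Irreducibility forces a max-clique above it to
  -- contain some `q` avoiding `p`; this `q` meets every hyperedge through `p`.
  have hclique : S.lineGraph.IsClique {e | p ∈ e.1} := fun e he e' he' hne =>
    ⟨hne, p, he, he'⟩
  obtain ⟨Q, hpQ, hQ⟩ := Finite.exists_le_maximal hclique
  have hq : ∃ q ∈ Q, p ∉ q.1 := by
    by_contra! h
    have h1 := hS.inter_eq_empty Q hQ
    exact h1.le (Set.mem_iInter₂.mpr h : p ∈ ⋂ h ∈ Q, (h : Set (Party N)))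
  obtain ⟨q, hqQ, hpq⟩ := hq
  obtain ⟨X, -, hX, hXq⟩ := S.mem_edgeSet_iff.mp q.2
  rw [← hXq, Finset.mem_coe] at hpq
  have hXu : X ⊆ Y ∪ Z := by
    rw [hu]
    intro a ha
    rw [Finset.mem_compl, Finset.mem_singleton]
    rintro rfl
    exact hpq ha
  have hpYZ : p ∉ Y ∪ Z := by
    rw [hu]
    simp
  have key : ∀ Y Z : Subsystem N, Z.Nonempty → Disjoint Y Z → Y ∪ Z = {p}ᶜ →
      S.ent Y + S.ent Z = S.ent {p}ᶜ → p ∉ Y ∪ Z → X ⊆ Y → False := by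
    intro Y Z hZ hd hu he hpYZ hXY
    have hd' := Finset.disjoint_left.mp hd
    -- Here `Z ∪ {p} = Yᶜ`. If the component `W` of `p` were `{p}`, then `f {p} + f Z = f Y` and `f
    -- Y + f Z = f {p}` would give `f Z = 0`. So `W` is a hyperedge through `p`, disjoint from `X ⊆
    -- Y`.
    obtain ⟨W, hW, hpW, hWs, hWe⟩ := hf.exists_component (insert p Z) (Finset.mem_insert_self p Z)
    have hpY : p ∉ Y := fun h => hpYZ (Finset.mem_union_left _ h)
    have hpZ : p ∉ Z := fun h => hpYZ (Finset.mem_union_right _ h)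
    have hWp : W ≠ {p} := by
      rintro rfl
      have h1 : insert p Z \ {p} = Z := by
        rw [Finset.sdiff_singleton_eq_erase, Finset.erase_insert hpZ]
      have h2 : insert p Z = Yᶜ := by
        ext a
        have h3 := Finset.ext_iff.mp hu a
        have h4 := @hd' a
        simp only [Finset.mem_union, Finset.mem_compl, Finset.mem_insert,
          Finset.mem_singleton] at h3 ⊢
        have h5 : a = p → a ∉ Y := fun h => h ▸ hpY
        tauto
      rw [h1, h2, hf.compl] at hWe
      rw [hf.compl] at he
      have := hf.pos Z hZ ⟨p, Finset.mem_compl.mpr hpZ⟩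
      linarith
    have hcard : 2 ≤ W.card := by
      by_contra hlt
      have h1 := Finset.card_pos.mpr ⟨p, hpW⟩
      obtain ⟨a, ha⟩ := Finset.card_eq_one.mp (by omega : W.card = 1)
      rw [ha, Finset.mem_singleton] at hpW
      exact hWp (hpW ▸ ha)
    let w : S.correlationHypergraph.edgeSet :=
      ⟨(W : Set (Party N)), S.mem_edgeSet_iff.mpr ⟨W, hcard, hW, rfl⟩⟩
    have hwQ : w ∈ Q := hpQ hpW
    have hqw : q ≠ w := by
      intro h
      have h1 : (X : Set (Party N)) = W := hXq.trans (congrArg Subtype.val h)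
      exact hpq (Finset.coe_injective h1 ▸ hpW)
    obtain ⟨-, a, ha, haW⟩ := hQ.prop hqQ hwQ hqw
    rw [← hXq] at ha
    rcases Finset.mem_insert.mp (hWs haW) with rfl | haZ
    · exact hpq ha
    · exact hd' (hXY ha) haZ
  rcases hX.subset_or_subset hf hd (by rw [he, hu]) hXu with h | h
  · exact key Y Z hZ hd hu he hpYZ h
  · exact key Z Y hY hd.symm (by rw [Finset.union_comm, hu]) (by linarith)
      (by rwa [Finset.union_comm]) h

/-- For an irreducible entropy vector with chordal line graph, the correlated sets with correlated
complement form a laminar family. -/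
theorem IsIrreducible.isRootedLaminar (hS : S.IsIrreducible) (hG : S.lineGraph.IsChordalGraph) :
    IsRootedLaminar fun K : Subsystem N =>
      IsCorrelated S.ent K ∧ IsCorrelated S.ent Kᶜ ∧ (0 : Party N) ∉ K where
  nonempty K hK := hK.1.1
  zero_notMem K hK := hK.2.2
  singleton p hp :=
    ⟨isCorrelated_singleton _ p,
      hS.isCorrelated_compl_singleton ⟨0, by simpa using Ne.symm hp⟩, by simpa using Ne.symm hp⟩
  laminar := by
    rintro J K ⟨hJ, hJc, hJ0⟩ ⟨hK, hKc, hK0⟩ ⟨a, ha⟩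
    by_contra! h
    obtain ⟨b, hbJ, hbK⟩ := Finset.not_subset.mp h.1
    obtain ⟨c, hcK, hcJ⟩ := Finset.not_subset.mp h.2
    obtain ⟨haJ, haK⟩ := Finset.mem_inter.mp ha
    have hcard : ∀ {X : Subsystem N} {x y : Party N}, x ∈ X → y ∈ X → x ≠ y → 2 ≤ X.card :=
      fun hx hy hxy => Finset.one_lt_card.mpr ⟨_, hx, _, hy, hxy⟩
    let edge (X : Subsystem N) (h2 : 2 ≤ X.card) (hX : IsCorrelated S.ent X) :
        S.correlationHypergraph.edgeSet := ⟨X, S.mem_edgeSet_iff.mpr ⟨X, h2, hX, rfl⟩⟩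
    let eJ := edge J (hcard haJ hbJ fun h => hbK (h ▸ haK)) hJ
    let eK := edge K (hcard haK hcK fun h => hcJ (h ▸ haJ)) hK
    let eJc := edge Jᶜ (hcard (Finset.mem_compl.mpr hJ0) (Finset.mem_compl.mpr hcJ)
      fun h => hK0 (h ▸ hcK)) hJc
    let eKc := edge Kᶜ (hcard (Finset.mem_compl.mpr hK0) (Finset.mem_compl.mpr hbK)
      fun h => hJ0 (h ▸ hbJ)) hKc
    have hne : ∀ {e e' : S.correlationHypergraph.edgeSet} (x : Party N), x ∈ e.1 → x ∉ e'.1 →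
        e ≠ e' := fun x hx hx' he => hx' (he ▸ hx)
    have mc : ∀ {X : Subsystem N} {x : Party N}, x ∉ X → x ∈ ((Xᶜ : Subsystem N) : Set (Party N)) :=
      fun h => Finset.mem_coe.mpr (Finset.mem_compl.mpr h)
    have nc : ∀ {X : Subsystem N} {x : Party N}, x ∈ X → x ∉ ((Xᶜ : Subsystem N) : Set (Party N)) :=
      fun h h' => Finset.mem_compl.mp (Finset.mem_coe.mp h') h
    -- Consecutive sets share `a`, `c`, the purifier and `b` respectively; opposite sets are
    -- complementary, so neither diagonal is an edge.
    refine hG.not_four_cycle (a := eJ) (b := eK) (c := eJc) (d := eKc)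
      ⟨hne b hbJ hbK, a, haJ, haK⟩ ⟨hne a haK (nc haJ), c, hcK, mc hcJ⟩
      ⟨hne c (mc hcJ) (nc hcK), 0, mc hJ0, mc hK0⟩ ⟨hne 0 (mc hK0) hJ0, b, mc hbK, hbJ⟩
      (hne a haJ (nc haJ)) (hne a haK (nc haK)) ?_ ?_
    · rintro ⟨-, x, hx, hx'⟩
      exact nc hx hx'
    · rintro ⟨-, x, hx, hx'⟩
      exact nc hx hx'

end EntropyVector

theorem theorem2 {N : ℕ} (S : EntropyVector N) (hS : S.IsIrreducible) :
    (∃ M : HolographicGraphModel N, M.IsSimpleTree ∧ M.Realizes S) ↔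
      S.lineGraph.IsChordalGraph := by
  constructor
  · rintro ⟨M, hM, hR⟩
    exact hS.isChordalGraph_lineGraph hM hR
  · intro hG
    have hF := hS.isRootedLaminar hG
    have hf := hS.isPureEntropy
    exact ⟨hF.treeModel hf, hF.isSimpleTree_treeModel hf,
      (hF.computes_treeModel hf fun K h1 h2 h3 => ⟨h1, h2, h3⟩).realizes⟩
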